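/- Consider games with $n$ players, a finite nonempty set $\mathcal A$ of $m$ actions and an arbitrary (possibly infinite) type space $\mathcal T$. In a single-dimensional $\gamma$-quasi-aggregative game $G$ there are a function $S:\mathcal A^n\to[-W,W]\subset\mathbb R$ (the aggregator, not necessarily linear) with $|S(x_i,x_{-i})-S(x_i',x_{-i})|\le\gamma$ for all players $i$, all $x_i,x_i'\in\mathcal A$ and all $x_{-i}\in\mathcal A^{n-1}$, and a utility function $u:\mathcal T\times\mathcal A\times[-W,W]\to\mathbb R$ with $|u(\tau,a,s)-u(\tau,a,s')|\le|s-s'|$ for all $\tau\in\mathcal T$, $a\in\mathcal A$ and $s,s'\in[-W,W]$; a player $i$ of type $t_i$ receives $u_i(x)=u(t_i,x_i,S(x))\in[-1,1]$ at the profile $x\in\mathcal A^n$. A mediator is a randomized map $M:(\mathcal T\cup\{\perp\})^n\to\mathcal A^n$. In the mediated game $G_M$ each player $i$ either opts in, choosing a report $r_i\in\mathcal T$ and an arbitrary function $f_i:\mathcal A\to\mathcal A$, or opts out, choosing $r_i=\perp$ and a constant function $f_i$; the utility of $i$ is $u_i'(r,f)=\mathbb E_{x\sim M(r)}[u_i(f_1(x_1),\dots,f_n(x_n))]$,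 where $u_i$ is taken with the true type $t_i$. Good behavior is the strategy $t_i\mapsto(t_i,\mathrm{id})$. A strategy profile is an $\eta$-approximate ex-post Nash equilibrium of $G_M$ if, for every type vector $t\in\mathcal T^n$, no player can gain more than $\eta$ by deviating unilaterally to another action of $G_M$. Theorem. There are absolute constants $C$ and $k$ such that for all $n$, $\mathcal T$, $\mathcal A$, $W$, every $\gamma<1$, and every single-dimensional $\gamma$-quasi-aggregative game $G$ as above there are a mediator $M$ and a number $$\eta\le C\sqrt{\gamma}\,(1+\log n+\log m)^k,$$ that is, $\eta=O(\sqrt\gamma\cdot\mathrm{polylog}(n,m))$, such that (i) good behavior is an $\eta$-approximate ex-post Nash equilibrium of $G_M$, and (ii) $M$ implements an approximate Nash equilibrium of the underlying game: for every type vector $t\in\mathcal T^n$, with probability one, $x\sim M(t)$ is an $\eta$-approximate pure strategy Nash equilibrium of the complete information game with types $t$, i.e. $u_i(x)\ge u_i(a,x_{-i})-\eta$ for all players $i$ and all $a\in\mathcal A$. -/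

import Mathlib

universe u v

/-- A single-dimensional `γ`-quasi-aggregative game with `n` players, type space `T` and action
set `A`. The aggregator `S` takes values in `[-W, W]` and is otherwise arbitrary; a player of type
`t` who plays `a` while the aggregator is `s` receives `util t a s`. The values of `util` outside
`[-W, W]` are irrelevant. -/
structure QuasiAggregativeGame (γ : ℝ) (n : ℕ) (T : Type v) (A : Type u) where
  /-- bound on the aggregator -/
  W : ℝ
  /-- the aggregator -/
  S : (Fin n → A) → ℝ
  /-- the utility, as a function of type, own action and aggregator -/
  util : T → A → ℝ → ℝ
  S_mem : ∀ x, S x ∈ Set.Icc (-W) W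
  util_mem : ∀ (t : T) (x : Fin n → A) (i : Fin n), util t (x i) (S x) ∈ Set.Icc (-1 : ℝ) 1
  influence : ∀ (x : Fin n → A) (i : Fin n) (a : A), |S (Function.update x i a) - S x| ≤ γ
  lipschitz : ∀ (t : T) (a : A), LipschitzOnWith 1 (util t a) (Set.Icc (-W) W)

namespace QuasiAggregativeGame

variable {γ : ℝ} {n : ℕ} {T : Type v} {A : Type u}

/-- Utility of player `i` at the action profile `x` when the types are `t`. -/
def payoff (G : QuasiAggregativeGame γ n T A) (t : Fin n → T) (i : Fin n) (x : Fin n → A) : ℝ :=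
  G.util (t i) (x i) (G.S x)

/-- `x` is an `η`-approximate pure strategy Nash equilibrium of the complete information game
with types `t`. -/
def IsApproxNash (G : QuasiAggregativeGame γ n T A) (t : Fin n → T) (η : ℝ) (x : Fin n → A) :
    Prop :=
  ∀ (i : Fin n) (a : A), G.payoff t i (Function.update x i a) - η ≤ G.payoff t i x

end QuasiAggregativeGame

/-- A mediator maps reports (`none` for a player who opts out) to a random profile of suggested
actions. -/
abbrev Mediator (n : ℕ) (T : Type v) (A : Type u) : Type (max u v) :=
  (Fin n → Option T) → PMF (Fin n → A)

/-- An action in the mediated game: report some type (or opt out, reporting `none`), and apply the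
function `response` to the suggested action. A player who opts out must use a constant function. -/
structure MediatedAction (T : Type v) (A : Type u) where
  report : Option T
  response : A → A
  const_of_optOut : report = none → ∃ a, ∀ r, response r = a

/-- Good behavior: report the true type and follow the suggestion. -/
def goodBehavior {T : Type v} {A : Type u} (t : T) : MediatedAction T A where
  report := some t
  response := id
  const_of_optOut h := by cases h

namespace QuasiAggregativeGame

variable {γ : ℝ} {n : ℕ} {T : Type v} {A : Type u} [Fintype A]

/-- Expected utility of player `i` in the game mediated by `M`, when the true types are `t` and
the players use the mediated actions `b`. -/
noncomputable def mediatedPayoff (G : QuasiAggregativeGame γ n T A) (M : Mediator n T A)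
    (t : Fin n → T) (i : Fin n) (b : Fin n → MediatedAction T A) : ℝ :=
  ∑ x : Fin n → A, (M (fun j => (b j).report) x).toReal *
    G.payoff t i (fun j => (b j).response (x j))

/-- The strategies `σ` form an `η`-approximate ex-post Nash equilibrium of the game mediated
by `M`. -/
def IsExPostNash (G : QuasiAggregativeGame γ n T A) (M : Mediator n T A) (η : ℝ)
    (σ : Fin n → T → MediatedAction T A) : Prop :=
  ∀ (t : Fin n → T) (i : Fin n) (b : MediatedAction T A),
    G.mediatedPayoff M t i (Function.update (fun j => σ j (t j)) i b) - η ≤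
      G.mediatedPayoff M t i (fun j => σ j (t j))

end QuasiAggregativeGame

/-! Fix the reports. Along a path of `n * n + 1` profiles the players switch, one at a time, to best
responses to a target that climbs from the minimum of the aggregator to its maximum. The `gap`
(aggregator minus target) goes from nonnegative to nonpositive in steps of at most `2 * γ`, so it is
nearly zero somewhere, and a profile with small gap is an approximate equilibrium
(`isApproxNash_profilePath`). The mediator samples the index `p` with weights decaying in `|gap| /
√γ`. One report moves every gap by at most `γ`, hence the law of `p` by `O(√γ)` in total variation.
Truncating the weights makes every sampled profile an approximate equilibrium. Given `p`, the
others' actions ignore player `i`'s report, so any deviation amounts to this small change of law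
plus a unilateral deviation from an approximate equilibrium. -/

open Real

/-! ### Normalized weights and total variation -/

/-- The distribution on a finite type with probabilities proportional to `w`. -/
noncomputable def weightedPMF {ι : Type*} [Fintype ι] (w : ι → ℝ) (hw : ∀ p, 0 ≤ w p)
    (hpos : 0 < ∑ p, w p) : PMF ι :=
  PMF.ofFintype (fun p => ENNReal.ofReal (w p / ∑ q, w q)) (by
    rw [← ENNReal.ofReal_sum_of_nonneg (fun p _ => div_nonneg (hw p) hpos.le),
      ← Finset.sum_div, div_self hpos.ne', ENNReal.ofReal_one])

lemma weightedPMF_toReal {ι : Type*} [Fintype ι] (w : ι → ℝ) (hw : ∀ p, 0 ≤ w p)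
    (hpos : 0 < ∑ p, w p) (p : ι) : (weightedPMF w hw hpos p).toReal = w p / ∑ q, w q := by
  rw [weightedPMF, PMF.ofFintype_apply, ENNReal.toReal_ofReal (div_nonneg (hw p) hpos.le)]

lemma pos_of_mem_support_weightedPMF {ι : Type*} [Fintype ι] {w : ι → ℝ} {hw : ∀ p, 0 ≤ w p}
    {hpos : 0 < ∑ p, w p} {p : ι} (h : p ∈ (weightedPMF w hw hpos).support) : 0 < w p := by
  refine lt_of_le_of_ne (hw p) fun h0 => ?_
  rw [PMF.mem_support_iff, weightedPMF, PMF.ofFintype_apply, ← h0] at h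
  simp at h

lemma sum_map_toReal_mul {ι α : Type*} [Fintype ι] [Fintype α] (μ : PMF ι) (f : ι → α)
    (h : α → ℝ) :
    ∑ x, (PMF.map f μ x).toReal * h x = ∑ p, (μ p).toReal * h (f p) := by
  classical
  have key : ∀ x, (PMF.map f μ x).toReal = ∑ p, if x = f p then (μ p).toReal else 0 := by
    intro x
    rw [PMF.map_apply, tsum_fintype, ENNReal.toReal_sum]
    · refine Finset.sum_congr rfl fun p _ => ?_
      split_ifs <;> simp
    · intro p _
      split_ifs
      · exact PMF.apply_ne_top μ p
      · exact ENNReal.zero_ne_top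
  simp_rw [key, Finset.sum_mul, ite_mul, zero_mul]
  rw [Finset.sum_comm]
  simp

/-- Normalizing weights that are close relative to their sum gives distributions that are close
in total variation. -/
lemma sum_abs_div_sub_div_le {ι : Type*} [Fintype ι] {w w' : ι → ℝ} {δ : ℝ}
    (hw' : ∀ p, 0 ≤ w' p) (hpos : 0 < ∑ p, w p) (hpos' : 0 < ∑ p, w' p)
    (h : ∑ p, |w' p - w p| ≤ δ * ∑ p, w p) :
    ∑ p, |w' p / ∑ q, w' q - w p / ∑ q, w q| ≤ 2 * δ := by
  set Z := ∑ p, w p with hZ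
  set Z' := ∑ p, w' p with hZ'
  have hdiff : |Z - Z'| ≤ ∑ p, |w' p - w p| := by
    rw [abs_sub_comm, hZ, hZ', ← Finset.sum_sub_distrib]
    exact Finset.abs_sum_le_sum_abs _ _
  have hterm : ∀ p, |w' p / Z' - w p / Z| ≤ |w' p - w p| / Z + w' p * (|Z - Z'| / (Z * Z')) := by
    intro p
    -- Change the weight first, then the normalizer; each change costs `δ` after summation.
    have e : w' p / Z' - w p / Z = (w' p - w p) / Z + w' p * ((Z - Z') / (Z * Z')) := by
      field_simp
      ring
    rw [e]
    refine (abs_add_le _ _).trans_eq ?_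
    rw [abs_div, abs_mul, abs_div, abs_of_pos hpos, abs_of_nonneg (hw' p),
      abs_of_pos (mul_pos hpos hpos')]
  calc ∑ p, |w' p / Z' - w p / Z|
      ≤ ∑ p, (|w' p - w p| / Z + w' p * (|Z - Z'| / (Z * Z'))) :=
        Finset.sum_le_sum fun p _ => hterm p
    _ = (∑ p, |w' p - w p|) / Z + |Z - Z'| / Z := by
        rw [Finset.sum_add_distrib, ← Finset.sum_div, ← Finset.sum_mul, ← hZ']
        congr 1
        field_simp
    _ ≤ δ + δ := add_le_add ((div_le_iff₀ hpos).2 h) ((div_le_iff₀ hpos).2 (hdiff.trans h))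
    _ = 2 * δ := by ring

/-! ### Truncated exponential weights -/

/-- The weight of the exponential mechanism, truncated so that it vanishes at bad candidates. -/
noncomputable def truncExp (τ y : ℝ) : ℝ := max (exp (-y) - τ) 0

lemma truncExp_nonneg (τ y : ℝ) : 0 ≤ truncExp τ y := le_max_right _ _

lemma lt_log_of_truncExp_pos {τ y : ℝ} (hτ : 0 < τ) (h : 0 < truncExp τ y) : y < log (1 / τ) := by
  have h1 : τ < exp (-y) := by
    rcases lt_max_iff.1 h with h | h
    · linarith
    · exact absurd h (lt_irrefl _)
  have h2 := (lt_log_iff_exp_lt (x := log τ) (y := exp (-y)) (exp_pos _)).2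
    (by rwa [exp_log hτ])
  rw [log_exp] at h2
  rw [one_div, log_inv]
  linarith

/-- Subtracting `τ`, rather than cutting off at `τ`, keeps the weight continuous. The additive `τ`
remains because a vanishing weight can still hide an exponential as large as `τ`. -/
lemma abs_truncExp_sub_le {τ y z ε : ℝ} (hε : ε ≤ 1) (h : |z - y| ≤ ε) :
    |truncExp τ z - truncExp τ y| ≤ 2 * ε * (truncExp τ y + τ) := by
  have h0 : 0 ≤ ε := (abs_nonneg _).trans h
  have h1 : |truncExp τ z - truncExp τ y| ≤ |exp (-z) - exp (-y)| := by
    refine (abs_max_sub_max_le_abs _ _ _).trans_eq ?_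
    congr 1
    ring
  have h2 : exp (-z) - exp (-y) = exp (-y) * (exp (y - z) - 1) := by
    rw [mul_sub, ← exp_add]
    ring_nf
  have h3 : |exp (y - z) - 1| ≤ 2 * ε := by
    rw [abs_sub_comm] at h
    exact (abs_exp_sub_one_le (h.trans hε)).trans (by linarith)
  have h4 : exp (-y) ≤ truncExp τ y + τ := by
    linarith [le_max_left (exp (-y) - τ) 0, show truncExp τ y = max (exp (-y) - τ) 0 from rfl]
  calc |truncExp τ z - truncExp τ y| ≤ exp (-y) * |exp (y - z) - 1| := by
        rwa [h2, abs_mul, abs_of_pos (exp_pos _)] at h1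
    _ ≤ (truncExp τ y + τ) * (2 * ε) :=
        mul_le_mul h4 h3 (abs_nonneg _) ((exp_pos _).le.trans h4)
    _ = 2 * ε * (truncExp τ y + τ) := by ring

/-! ### Discrete continuity and one-at-a-time switching -/

/-- A sequence that goes from nonnegative to nonpositive in steps of size at most `c` is somewhere
at most `c` in absolute value. -/
lemma exists_abs_le_of_step_le {g : ℕ → ℝ} {c : ℝ} {N : ℕ} (hc : 0 ≤ c) (h0 : 0 ≤ g 0)
    (hN : g N ≤ 0) (hstep : ∀ p, |g (p + 1) - g p| ≤ c) : ∃ p ≤ N, |g p| ≤ c := by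
  induction N with
  | zero => exact ⟨0, le_rfl, by rwa [le_antisymm hN h0, abs_zero]⟩
  | succ N ih =>
    rcases le_total (g N) 0 with h | h
    · obtain ⟨p, hp, hp'⟩ := ih h
      exact ⟨p, hp.trans N.le_succ, hp'⟩
    · refine ⟨N, N.le_succ, ?_⟩
      rw [abs_of_nonneg h]
      linarith [(abs_le.1 (hstep N)).1]

/-- When `p` increases by one, at most one of the numbers `(p + j) / n` with `j < n` changes. -/
lemma exists_forall_succ_add_div_eq {n : ℕ} (hn : 0 < n) (p : ℕ) :
    ∃ i : Fin n, ∀ j : Fin n, j ≠ i → (p + 1 + j) / n = (p + j) / n := by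
  have hmod := Nat.mod_lt p hn
  -- The quotient jumps only for the `i` with `p + i + 1` divisible by `n`.
  refine ⟨⟨n - 1 - p % n, by omega⟩, fun j hj => ?_⟩
  have hnd : ¬ n ∣ (p + j) + 1 := by
    intro hd
    apply hj
    ext
    have h1 : n ∣ p % n + j + 1 := by
      have e : p + j + 1 = n * (p / n) + (p % n + j + 1) := by
        have := Nat.div_add_mod p n
        omega
      rw [e] at hd
      exact (Nat.dvd_add_right (dvd_mul_right _ _)).1 hd
    obtain ⟨c, hc⟩ := h1
    have hj' := j.2
    have hc1 : c = 1 := by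
      rcases Nat.lt_or_ge c 2 with h | h
      · interval_cases c
        · omega
        · rfl
      · have : n * 2 ≤ n * c := Nat.mul_le_mul_left n h
        omega
    subst hc1
    simp only
    omega
  rw [show p + 1 + (j : ℕ) = p + j + 1 by ring, Nat.succ_div_of_not_dvd hnd]

/-! ### Aggregator bounds, best responses and the path of profiles -/

namespace QuasiAggregativeGame

variable {γ : ℝ} {n : ℕ} {T : Type v} {A : Type u}

lemma abs_S_sub_le (G : QuasiAggregativeGame γ n T A) {x y : Fin n → A} {i : Fin n}
    (h : ∀ j, j ≠ i → x j = y j) : |G.S x - G.S y| ≤ γ := by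
  have e : x = Function.update y i (x i) := by
    ext j
    by_cases hj : j = i
    · subst hj; simp
    · simp [hj, h j hj]
  rw [e]
  exact G.influence y i _

lemma S_sub_le (G : QuasiAggregativeGame γ n T A) (x y : Fin n → A) :
    G.S x - G.S y ≤ n * γ := by
  have key : ∀ s : Finset (Fin n), G.S (s.piecewise x y) - G.S y ≤ s.card * γ := by
    intro s
    induction s using Finset.induction_on with
    | empty => simp
    | insert j s hj ih =>
      rw [Finset.piecewise_insert, Finset.card_insert_of_notMem hj]
      have := (abs_le.1 (G.influence (s.piecewise x y) j (x j))).2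
      push_cast
      linarith
  simpa using key Finset.univ

lemma util_le_add (G : QuasiAggregativeGame γ n T A) (t : T) (a : A) {s s' : ℝ}
    (hs : s ∈ Set.Icc (-G.W) G.W) (hs' : s' ∈ Set.Icc (-G.W) G.W) :
    G.util t a s ≤ G.util t a s' + |s - s'| := by
  have h := (G.lipschitz t a).dist_le_mul s hs s' hs'
  rw [Real.dist_eq, Real.dist_eq, NNReal.coe_one, one_mul] at h
  linarith [le_abs_self (G.util t a s - G.util t a s')]

lemma abs_payoff_le_one (G : QuasiAggregativeGame γ n T A) (t : Fin n → T) (i : Fin n)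
    (x : Fin n → A) : |G.payoff t i x| ≤ 1 :=
  abs_le.2 (G.util_mem (t i) x i)

variable [Fintype A] [Nonempty A]

/-- A best response to the value `s` of the aggregator; arbitrary for a player who opts out. -/
noncomputable def bestResponse (G : QuasiAggregativeGame γ n T A) : Option T → ℝ → A
  | none, _ => Classical.arbitrary A
  | some t, s => (Finite.exists_max fun a => G.util t a s).choose

lemma util_le_util_bestResponse (G : QuasiAggregativeGame γ n T A) (t : T) (s : ℝ) (a : A) :
    G.util t a s ≤ G.util t (G.bestResponse (some t) s) s :=
  (Finite.exists_max fun a => G.util t a s).choose_spec a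

/-- The least value of the aggregator. -/
noncomputable def minS (G : QuasiAggregativeGame γ n T A) : ℝ :=
  G.S (Finite.exists_min G.S).choose

/-- The difference between the greatest and the least value of the aggregator. -/
noncomputable def spread (G : QuasiAggregativeGame γ n T A) : ℝ :=
  G.S (Finite.exists_max G.S).choose - G.minS

lemma minS_le (G : QuasiAggregativeGame γ n T A) (x : Fin n → A) : G.minS ≤ G.S x :=
  (Finite.exists_min G.S).choose_spec x

lemma S_le_minS_add_spread (G : QuasiAggregativeGame γ n T A) (x : Fin n → A) :
    G.S x ≤ G.minS + G.spread := by
  have := (Finite.exists_max G.S).choose_spec x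
  rw [spread]
  linarith

lemma spread_nonneg (G : QuasiAggregativeGame γ n T A) : 0 ≤ G.spread :=
  sub_nonneg.2 (G.minS_le _)

lemma spread_le (G : QuasiAggregativeGame γ n T A) : G.spread ≤ n * γ := G.S_sub_le _ _

lemma minS_add_mem (G : QuasiAggregativeGame γ n T A) {c : ℝ} (h0 : 0 ≤ c) (h1 : c ≤ 1) :
    G.minS + G.spread * c ∈ Set.Icc (-G.W) G.W := by
  have hs := G.spread_nonneg
  have h2 : G.minS + G.spread ≤ G.W := by
    rw [spread]
    linarith [(G.S_mem (Finite.exists_max G.S).choose).2]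
  have h3 : -G.W ≤ G.minS := (G.S_mem _).1
  constructor <;> nlinarith

/-- The value of the aggregator to which player `i` responds at the `p`-th profile. -/
noncomputable def localTarget (G : QuasiAggregativeGame γ n T A) (p : ℕ) (i : Fin n) : ℝ :=
  G.minS + G.spread * (((p + i) / n : ℕ) / n)

/-- The value of the aggregator that the `p`-th profile is meant to have. -/
noncomputable def target (G : QuasiAggregativeGame γ n T A) (p : ℕ) : ℝ :=
  G.minS + G.spread * (p / (n * n))

/-- A path of profiles in which the players switch one by one to the best response to the next
value of the aggregator. -/
noncomputable def profilePath (G : QuasiAggregativeGame γ n T A) (r : Fin n → Option T) (p : ℕ) :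
    Fin n → A :=
  fun i => G.bestResponse (r i) (G.localTarget p i)

/-- How far the `p`-th profile is from being consistent with its target. -/
noncomputable def gap (G : QuasiAggregativeGame γ n T A) (r : Fin n → Option T) (p : ℕ) : ℝ :=
  G.S (G.profilePath r p) - G.target p

lemma localTarget_mem (G : QuasiAggregativeGame γ n T A) {p : ℕ} (hp : p ≤ n * n) (i : Fin n) :
    G.localTarget p i ∈ Set.Icc (-G.W) G.W := by
  have hn : 0 < n := i.pos
  refine G.minS_add_mem (by positivity) ?_
  rw [div_le_one (by positivity)]
  have : (p + i) / n ≤ n := by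
    have : (p + i) / n < n + 1 := by
      rw [Nat.div_lt_iff_lt_mul hn]
      have := i.2
      nlinarith
    omega
  exact_mod_cast this

/-- Rounding to a multiple of `1 / n` moves the target by at most `spread / n`, and `spread ≤ n *
γ`. -/
lemma abs_localTarget_sub_target_le (G : QuasiAggregativeGame γ n T A) (p : ℕ) (i : Fin n) :
    |G.localTarget p i - G.target p| ≤ γ := by
  have hn : 0 < n := i.pos
  have hn' : (0 : ℝ) < n := by exact_mod_cast hn
  have hi := i.2
  set k := (p + (i : ℕ)) / n with hk
  have h1 : n * k ≤ p + i := Nat.mul_div_le _ _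
  have h2 : p + i < n * (k + 1) := Nat.lt_mul_div_succ _ hn
  have h3 : (n : ℝ) * k ≤ p + n := by exact_mod_cast (by omega : n * k ≤ p + n)
  have h4 : (p : ℝ) ≤ n * k + n := by
    have : p ≤ n * k + n := by rw [Nat.mul_add] at h2; omega
    exact_mod_cast this
  have e : G.localTarget p i - G.target p = G.spread * ((n * k - p) / (n * n)) := by
    rw [localTarget, target, ← hk]
    field_simp
    ring
  rw [e, abs_mul, abs_of_nonneg G.spread_nonneg, abs_div, abs_of_pos (mul_pos hn' hn')]
  have h5 : |(n : ℝ) * k - p| / (n * n) ≤ 1 / n := by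
    rw [div_le_div_iff₀ (mul_pos hn' hn') hn']
    have : |(n : ℝ) * k - p| ≤ n := abs_le.2 ⟨by linarith, by linarith⟩
    nlinarith
  calc G.spread * (|(n : ℝ) * k - p| / (n * n)) ≤ (n * γ) * (1 / n) :=
        mul_le_mul G.spread_le h5 (by positivity) (G.spread_nonneg.trans G.spread_le)
    _ = γ := by field_simp

lemma abs_gap_sub_le (G : QuasiAggregativeGame γ n T A) {r r' : Fin n → Option T} {i : Fin n}
    (h : ∀ j, j ≠ i → r j = r' j) (p : ℕ) : |G.gap r p - G.gap r' p| ≤ γ := by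
  rw [gap, gap, sub_sub_sub_cancel_right]
  exact G.abs_S_sub_le (i := i) fun j hj => by rw [profilePath, profilePath, h j hj]

lemma abs_gap_succ_sub_le (G : QuasiAggregativeGame γ n T A) (hn : 0 < n)
    (r : Fin n → Option T) (p : ℕ) : |G.gap r (p + 1) - G.gap r p| ≤ 2 * γ := by
  obtain ⟨i, hi⟩ := exists_forall_succ_add_div_eq hn p
  have h1 : |G.S (G.profilePath r (p + 1)) - G.S (G.profilePath r p)| ≤ γ :=
    G.abs_S_sub_le (i := i) fun j hj => by
      rw [profilePath, profilePath, localTarget, localTarget, hi j hj]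
  have hn' : (1 : ℝ) ≤ n := by exact_mod_cast hn
  have hγ : 0 ≤ γ := (abs_nonneg _).trans h1
  have e : G.target (p + 1) - G.target p = G.spread / (n * n) := by
    rw [target, target]
    push_cast
    field_simp
    ring
  have h2 : 0 ≤ G.spread / (n * n) := div_nonneg G.spread_nonneg (by positivity)
  have h3 : G.spread / (n * n) ≤ γ := by
    rw [div_le_iff₀ (by positivity)]
    refine G.spread_le.trans ?_
    have : (n : ℝ) * γ ≤ n * γ * n := le_mul_of_one_le_right (by positivity) hn'
    linarith
  rw [abs_le] at h1 ⊢
  rw [gap, gap]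
  constructor <;> linarith

lemma exists_abs_gap_le (G : QuasiAggregativeGame γ n T A) (hn : 0 < n) (hγ : 0 ≤ γ)
    (r : Fin n → Option T) : ∃ p ≤ n * n, |G.gap r p| ≤ 2 * γ := by
  refine exists_abs_le_of_step_le (by linarith) ?_ ?_ (G.abs_gap_succ_sub_le hn r)
  · have := G.minS_le (G.profilePath r 0)
    simpa [gap, target] using this
  · have := G.S_le_minS_add_spread (G.profilePath r (n * n))
    have hn' : (n : ℝ) ≠ 0 := by exact_mod_cast hn.ne'
    rw [gap, target, Nat.cast_mul, div_self (mul_ne_zero hn' hn')]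
    linarith

lemma abs_gap_le_spread (G : QuasiAggregativeGame γ n T A) (hn : 0 < n) (r : Fin n → Option T)
    {p : ℕ} (hp : p ≤ n * n) : |G.gap r p| ≤ G.spread := by
  have hs := G.spread_nonneg
  have h0 : (0 : ℝ) ≤ p / (n * n) := by positivity
  have h1 : (p : ℝ) / (n * n) ≤ 1 := by
    rw [div_le_one (by positivity)]
    exact_mod_cast hp
  rw [gap, target, abs_le]
  constructor <;>
    nlinarith [G.minS_le (G.profilePath r p), G.S_le_minS_add_spread (G.profilePath r p)]

/-- Each player best responds exactly to a local target within `Δ + γ` of the realized aggregator,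
and within `Δ + 2 * γ` of the aggregator after a deviation; the Lipschitz bound charges both. -/
lemma isApproxNash_profilePath (G : QuasiAggregativeGame γ n T A) (t : Fin n → T) {p : ℕ}
    (hp : p ≤ n * n) {Δ : ℝ} (h : |G.gap (fun i => some (t i)) p| ≤ Δ) :
    G.IsApproxNash t (2 * Δ + 3 * γ) (G.profilePath (fun i => some (t i)) p) := by
  intro i a
  set x := G.profilePath (fun i => some (t i)) p with hx
  have hl := G.localTarget_mem hp i
  have h1 := G.abs_localTarget_sub_target_le p i
  have h2 := G.influence x i a
  have h3 : |G.S x - G.target p| ≤ Δ := h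
  have h4 := G.util_le_add (t i) a (G.S_mem (Function.update x i a)) hl
  have h5 := G.util_le_util_bestResponse (t i) (G.localTarget p i) a
  have h6 := G.util_le_add (t i) (x i) hl (G.S_mem x)
  have h7 : |G.S (Function.update x i a) - G.localTarget p i| ≤ Δ + 2 * γ := by
    rw [abs_le] at *
    constructor <;> linarith
  have h8 : |G.localTarget p i - G.S x| ≤ Δ + γ := by
    rw [abs_le] at *
    constructor <;> linarith
  change G.util (t i) a (G.localTarget p i) ≤ G.util (t i) (x i) (G.localTarget p i) at h5
  rw [payoff, payoff, Function.update_self]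
  linarith

/-! ### The truncated exponential mediator -/

/-- The truncation level of the mediator. -/
noncomputable def truncLevel (n : ℕ) : ℝ := exp (-2) / (n * n + 2)

lemma truncLevel_pos (n : ℕ) : 0 < truncLevel n := div_pos (exp_pos _) (by positivity)

/-- The weight that the mediator gives to the `p`-th profile. -/
noncomputable def weight (G : QuasiAggregativeGame γ n T A) (r : Fin n → Option T)
    (p : Fin (n * n + 1)) : ℝ :=
  truncExp (truncLevel n) (|G.gap r p| / √γ)

lemma weight_nonneg (G : QuasiAggregativeGame γ n T A) (r : Fin n → Option T)
    (p : Fin (n * n + 1)) : 0 ≤ G.weight r p :=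
  truncExp_nonneg _ _

lemma truncLevel_mul_le_sum_weight (G : QuasiAggregativeGame γ n T A) (hn : 0 < n) (hγ : 0 ≤ γ)
    (hγ1 : γ < 1) (r : Fin n → Option T) : (n * n + 1) * truncLevel n ≤ ∑ p, G.weight r p := by
  obtain ⟨p, hp, hgap⟩ := G.exists_abs_gap_le hn hγ r
  have h1 : |G.gap r p| / √γ ≤ 2 := by
    refine div_le_of_le_mul₀ (sqrt_nonneg _) (by norm_num) (hgap.trans ?_)
    have : γ ≤ √γ := le_sqrt_of_sq_le (by nlinarith)
    linarith
  have h2 : exp (-2) ≤ exp (-(|G.gap r p| / √γ)) := exp_le_exp.2 (by linarith)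
  -- The denominator of `truncLevel` is chosen so that the near-zero gap retains weight `(n * n + 1)
  -- * truncLevel n`, enough to absorb the additive truncation errors of all candidates.
  have h3 : exp (-2) = (n * n + 2) * truncLevel n := by
    rw [truncLevel]
    field_simp
  have h4 : (n * n + 1) * truncLevel n ≤ G.weight r ⟨p, by omega⟩ := by
    refine le_trans ?_ (le_max_left _ _)
    simp only
    linarith
  exact h4.trans (Finset.single_le_sum (f := G.weight r) (fun q _ => G.weight_nonneg r q)
    (Finset.mem_univ _))

lemma sum_weight_pos (G : QuasiAggregativeGame γ n T A) (hn : 0 < n) (hγ : 0 ≤ γ)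
    (hγ1 : γ < 1) (r : Fin n → Option T) : 0 < ∑ p, G.weight r p :=
  (mul_pos (by positivity) (truncLevel_pos n)).trans_le
    (G.truncLevel_mul_le_sum_weight hn hγ hγ1 r)

lemma sum_abs_weight_sub_le (G : QuasiAggregativeGame γ n T A) (hγ1 : γ < 1)
    {r r' : Fin n → Option T} {i : Fin n} (h : ∀ j, j ≠ i → r' j = r j) :
    ∑ p, |G.weight r' p - G.weight r p| ≤ 4 * √γ * ∑ p, G.weight r p := by
  have hγ : 0 ≤ γ := (abs_nonneg _).trans (G.abs_gap_sub_le h 0)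
  have hle := G.truncLevel_mul_le_sum_weight i.pos hγ hγ1 r
  have hterm : ∀ p, |G.weight r' p - G.weight r p| ≤ 2 * √γ * (G.weight r p + truncLevel n) := by
    intro p
    refine abs_truncExp_sub_le (sqrt_le_one.2 hγ1.le) ?_
    rw [← sub_div, abs_div, abs_of_nonneg (sqrt_nonneg γ)]
    refine div_le_of_le_mul₀ (sqrt_nonneg _) (sqrt_nonneg _) ?_
    rw [mul_self_sqrt hγ]
    exact (abs_abs_sub_abs_le _ _).trans (G.abs_gap_sub_le h p)
  refine (Finset.sum_le_sum fun p _ => hterm p).trans ?_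
  rw [← Finset.mul_sum, Finset.sum_add_distrib, Finset.sum_const, Finset.card_univ,
    Fintype.card_fin, nsmul_eq_mul]
  push_cast
  nlinarith [sqrt_nonneg γ]

lemma abs_gap_le_of_weight_pos (G : QuasiAggregativeGame γ n T A) (hn : 0 < n) (hγ : 0 ≤ γ)
    {r : Fin n → Option T} {p : Fin (n * n + 1)} (h : 0 < G.weight r p) :
    |G.gap r p| ≤ √γ * log (1 / truncLevel n) := by
  rcases hγ.eq_or_lt with h0 | h0
  · subst h0
    -- For `γ = 0` the score is `0` by division by zero and carries no information, but then the
    -- spread is zero too.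
    simpa using (G.abs_gap_le_spread hn r (Nat.lt_succ_iff.1 p.2)).trans G.spread_le
  · have := lt_log_of_truncExp_pos (truncLevel_pos n) h
    rw [div_lt_iff₀ (sqrt_pos.2 h0)] at this
    linarith

/-- The mediator that samples a profile of the path by the truncated exponential mechanism. -/
noncomputable def expMediator (G : QuasiAggregativeGame γ n T A) (hn : 0 < n) (hγ : 0 ≤ γ)
    (hγ1 : γ < 1) : Mediator n T A := fun r =>
  (weightedPMF (G.weight r) (G.weight_nonneg r) (G.sum_weight_pos hn hγ hγ1 r)).map
    fun p : Fin (n * n + 1) => G.profilePath r p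

lemma mediatedPayoff_expMediator (G : QuasiAggregativeGame γ n T A) (hn : 0 < n) (hγ : 0 ≤ γ)
    (hγ1 : γ < 1) (t : Fin n → T) (i : Fin n) (b : Fin n → MediatedAction T A) :
    G.mediatedPayoff (G.expMediator hn hγ hγ1) t i b =
      ∑ p, (G.weight (fun j => (b j).report) p / ∑ q, G.weight (fun j => (b j).report) q) *
        G.payoff t i
          (fun j => (b j).response (G.profilePath (fun j => (b j).report) p j)) := by
  rw [mediatedPayoff, expMediator, sum_map_toReal_mul _ _
    (fun x : Fin n → A => G.payoff t i fun j => (b j).response (x j))]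
  simp_rw [weightedPMF_toReal]

lemma isApproxNash_of_weight_pos (G : QuasiAggregativeGame γ n T A) (hn : 0 < n) (hγ : 0 ≤ γ)
    (t : Fin n → T) {p : Fin (n * n + 1)} (h : 0 < G.weight (fun i => some (t i)) p) :
    G.IsApproxNash t (2 * (√γ * log (1 / truncLevel n)) + 3 * γ)
      (G.profilePath (fun i => some (t i)) p) :=
  G.isApproxNash_profilePath t (Nat.lt_succ_iff.1 p.2) (G.abs_gap_le_of_weight_pos hn hγ h)

lemma isExPostNash_expMediator (G : QuasiAggregativeGame γ n T A) (hn : 0 < n) (hγ : 0 ≤ γ)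
    (hγ1 : γ < 1) :
    G.IsExPostNash (G.expMediator hn hγ hγ1)
      (2 * (√γ * log (1 / truncLevel n)) + 3 * γ + 8 * √γ) (fun _ => goodBehavior) := by
  intro t i b
  rw [mediatedPayoff_expMediator, mediatedPayoff_expMediator]
  set η := 2 * (√γ * log (1 / truncLevel n)) + 3 * γ
  set b' : Fin n → MediatedAction T A := Function.update (fun j => goodBehavior (t j)) i b with hb'
  set r' : Fin n → Option T := fun j => (b' j).report with hr'
  change _ ≤ ∑ p : Fin (n * n + 1), (G.weight (fun j => some (t j)) p /
    ∑ q, G.weight (fun j => some (t j)) q) * G.payoff t i (G.profilePath (fun j => some (t j)) p)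
  set r : Fin n → Option T := fun j => some (t j) with hr
  have hoff : ∀ j, j ≠ i → r' j = r j := fun j hj => by simp [hr', hb', hr, hj, goodBehavior]
  -- Each action on the path depends only on `p` and the player's own report, so only coordinate `i`
  -- differs.
  have hprof : ∀ p : Fin (n * n + 1), (fun j => (b' j).response (G.profilePath r' p j)) =
      Function.update (G.profilePath r p) i (b.response (G.profilePath r' p i)) := by
    intro p
    ext j
    by_cases hj : j = i
    · subst hj; simp [hb']
    · rw [Function.update_of_ne hj, profilePath, profilePath, hoff j hj]
      simp [hb', hj, goodBehavior]
  simp_rw [hprof]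
  set y : Fin (n * n + 1) → Fin n → A := fun p =>
    Function.update (G.profilePath r p) i (b.response (G.profilePath r' p i))
  have hpos := G.sum_weight_pos hn hγ hγ1 r
  have hpos' := G.sum_weight_pos hn hγ hγ1 r'
  have htv := sum_abs_div_sub_div_le (G.weight_nonneg r') hpos hpos'
    (G.sum_abs_weight_sub_le hγ1 hoff)
  have hterm : ∀ p, G.weight r' p / (∑ q, G.weight r' q) * G.payoff t i (y p) ≤
      (G.weight r p / (∑ q, G.weight r q) * G.payoff t i (G.profilePath r p) +
        G.weight r p / (∑ q, G.weight r q) * η) +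
      |G.weight r' p / (∑ q, G.weight r' q) - G.weight r p / (∑ q, G.weight r q)| := by
    intro p
    have h1 : (G.weight r' p / (∑ q, G.weight r' q) - G.weight r p / (∑ q, G.weight r q)) *
        G.payoff t i (y p) ≤
        |G.weight r' p / (∑ q, G.weight r' q) - G.weight r p / (∑ q, G.weight r q)| := by
      refine (le_abs_self _).trans ?_
      rw [abs_mul]
      exact mul_le_of_le_one_right (abs_nonneg _) (G.abs_payoff_le_one t i (y p))
    have h2 : G.weight r p / (∑ q, G.weight r q) * G.payoff t i (y p) ≤
        G.weight r p / (∑ q, G.weight r q) * (G.payoff t i (G.profilePath r p) + η) := by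
      rcases (G.weight_nonneg r p).eq_or_lt with h0 | h0
      · rw [← h0, zero_div, zero_mul, zero_mul]
      · refine mul_le_mul_of_nonneg_left ?_ (div_nonneg h0.le hpos.le)
        have := G.isApproxNash_of_weight_pos hn hγ t h0 i (b.response (G.profilePath r' p i))
        simp only [y]
        linarith
    linarith
  have hsum := Finset.sum_le_sum fun p (_ : p ∈ Finset.univ) => hterm p
  rw [Finset.sum_add_distrib, Finset.sum_add_distrib, ← Finset.sum_mul _ _ η, ← Finset.sum_div,
    div_self hpos.ne', one_mul] at hsum
  linarith

lemma isApproxNash_of_mem_support_expMediator (G : QuasiAggregativeGame γ n T A) (hn : 0 < n)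
    (hγ : 0 ≤ γ) (hγ1 : γ < 1) (t : Fin n → T) {x : Fin n → A}
    (hx : x ∈ (G.expMediator hn hγ hγ1 (fun i => some (t i))).support) :
    G.IsApproxNash t (2 * (√γ * log (1 / truncLevel n)) + 3 * γ) x := by
  rw [expMediator, PMF.mem_support_map_iff] at hx
  obtain ⟨p, hp, rfl⟩ := hx
  exact G.isApproxNash_of_weight_pos hn hγ t (pos_of_mem_support_weightedPMF hp)

lemma log_one_div_truncLevel_le {n : ℕ} (hn : 0 < n) :
    log (1 / truncLevel n) ≤ 4 + 2 * log n := by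
  have hn' : (1 : ℝ) ≤ n := by exact_mod_cast hn
  have h1 : log (1 / truncLevel n) = 2 + log ((n : ℝ) * n + 2) := by
    rw [truncLevel, one_div_div, log_div (by positivity) (exp_pos _).ne', log_exp]
    ring
  have h2 : log ((n : ℝ) * n + 2) ≤ log (3 * (n * n)) :=
    log_le_log (by positivity) (by nlinarith)
  have h3 : log (3 * ((n : ℝ) * n)) = log 3 + (log n + log n) := by
    rw [log_mul (by norm_num) (by positivity), log_mul (by positivity) (by positivity)]
  have h4 : log 3 ≤ 3 - 1 := log_le_sub_one_of_pos (by norm_num)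
  linarith

end QuasiAggregativeGame

theorem mainTheorem3 :
    ∃ (C : ℝ) (k : ℕ), ∀ (n : ℕ) (T : Type v) (A : Type u) [Fintype A] [Nonempty A] (γ : ℝ)
      (G : QuasiAggregativeGame γ n T A), γ < 1 →
      ∃ (M : Mediator n T A) (η : ℝ),
        η ≤ C * √γ * (1 + Real.log n + Real.log (Fintype.card A)) ^ k ∧
        G.IsExPostNash M η (fun _ => goodBehavior) ∧
        ∀ (t : Fin n → T), ∀ x ∈ (M (fun i => some (t i))).support, G.IsApproxNash t η x := by
  -- `19 = 2 * 4 + 3 + 8`: logarithm bound, `γ ≤ √γ`, and total variation. No dependence on the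
  -- number of actions is needed.
  refine ⟨19, 1, fun n T A _ _ γ G hγ1 => ?_⟩
  have hcard : 0 ≤ log (Fintype.card A) := log_natCast_nonneg _
  have hlog : 0 ≤ log n := log_natCast_nonneg n
  have hs := sqrt_nonneg γ
  rcases Nat.eq_zero_or_pos n with rfl | hn
  · exact ⟨fun _ => PMF.pure fun _ => Classical.arbitrary A, 0, by positivity,
      fun _ i => i.elim0, fun _ _ _ i => i.elim0⟩
  have hγ : 0 ≤ γ := (abs_nonneg _).trans
    (G.influence (fun _ => Classical.arbitrary A) ⟨0, hn⟩ (Classical.arbitrary A))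
  refine ⟨G.expMediator hn hγ hγ1, _, ?_, G.isExPostNash_expMediator hn hγ hγ1,
    fun t x hx i a => ?_⟩
  · have h1 : √γ * log (1 / QuasiAggregativeGame.truncLevel n) ≤ √γ * (4 + 2 * log n) :=
      mul_le_mul_of_nonneg_left (QuasiAggregativeGame.log_one_div_truncLevel_le hn) hs
    have h2 : γ ≤ √γ := le_sqrt_of_sq_le (by nlinarith)
    rw [pow_one]
    nlinarith [mul_nonneg hs hcard, mul_nonneg hs hlog]
  · linarith [G.isApproxNash_of_mem_support_expMediator hn hγ hγ1 t hx i a]
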